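/- Let $(R,\mathfrak m,k)$ be a commutative noetherian local ring of depth $t$. For an integer $i\ge 0$ let $\mu_i(R)=\dim_k\operatorname{Ext}^i_R(k,R)$ be the $i$-th Bass number of $R$, and let $r(R)=\mu_t(R)$ be the type of $R$. For a projective presentation $P_1\xrightarrow{\partial}P_0\to M\to 0$ of a finitely generated $R$-module $M$ by finitely generated projective modules, put $\Omega M=\operatorname{Im}\partial$ and $\operatorname{Tr}M=\operatorname{Coker}(\operatorname{Hom}_R(\partial,R))$; both are determined by $M$ up to projective summands. Put $\Omega^0M=M$ and $\Omega^nM=\Omega(\Omega^{n-1}M)$ for $n>0$. Then, for every choice of the presentations used to form $\operatorname{Tr}\Omega^t k$, the module $\operatorname{Ext}^i_R(\operatorname{Tr}\Omega^t k,R)$ is a $k$-vector space (that is, it is annihilated by $\mathfrak m$) for all integers $i>0$, and the following hold. 1. $\operatorname{Ext}^i_R(\operatorname{Tr}\Omega^t k,R)=0$ for all integers $1\le i\le t+1$. 2. $\dim_k\operatorname{Ext}^{t+2}_R(\operatorname{Tr}\Omega^t k,R)=r(R)^2-1$. 3. $\dim_k\operatorname{Ext}^i_R(\operatorname{Tr}\Omega^t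 k,R)=r(R)\,\mu_{i-2}(R)$ for all integers $i\ge t+3$. -/

import Mathlib

universe u

open CategoryTheory CategoryTheory.Abelian IsLocalRing

namespace LocalSyzygy

noncomputable section

/-- A projective presentation `P₁ → P₀ → M → 0` of an `R`-module by finitely generated projective
modules. -/
structure ProjPresentation (R : Type u) [CommRing R] (M : ModuleCat.{u} R) where
  P₁ : ModuleCat.{u} R
  P₀ : ModuleCat.{u} R
  finite₁ : Module.Finite R P₁
  finite₀ : Module.Finite R P₀
  projective₁ : Module.Projective R P₁
  projective₀ : Module.Projective R P₀
  /-- the differential `P₁ → P₀` -/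
  d : P₁ →ₗ[R] P₀
  /-- the augmentation `P₀ → M` -/
  aug : P₀ →ₗ[R] M
  exact : Function.Exact d aug
  surjective : Function.Surjective aug

/-- `N` is a first syzygy of `M`: it is isomorphic to the image of the differential of some
projective presentation of `M`. -/
def IsSyzygy (R : Type u) [CommRing R] (M N : ModuleCat.{u} R) : Prop :=
  ∃ P : ProjPresentation R M, Nonempty (N ≃ₗ[R] LinearMap.range P.d)

/-- `N` is an `n`-th syzygy of `M`, with arbitrary choices of presentations at every step
(a zeroth syzygy of `M` is `M` itself). -/
def IsNthSyzygy (R : Type u) [CommRing R] : ℕ → ModuleCat.{u} R → ModuleCat.{u} R → Prop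
  | 0, M, N => Nonempty (N ≃ₗ[R] M)
  | n + 1, M, N => ∃ L : ModuleCat.{u} R, IsNthSyzygy R n M L ∧ IsSyzygy R L N

/-- `N` is an Auslander transpose of `M`: it is isomorphic to the cokernel of the dual
`P₀* → P₁*` of the differential of some projective presentation of `M`. -/
def IsTranspose (R : Type u) [CommRing R] (M N : ModuleCat.{u} R) : Prop :=
  ∃ P : ProjPresentation R M,
    Nonempty (N ≃ₗ[R] (Module.Dual R P.P₁ ⧸ LinearMap.range P.d.dualMap))

/-- The depth of a local ring: the supremum of the lengths of regular sequences in the maximal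
ideal. -/
def depth (R : Type u) [CommRing R] [IsLocalRing R] : ℕ∞ :=
  ⨆ rs : {rs : List R // (∀ r ∈ rs, r ∈ maximalIdeal R) ∧ RingTheory.Sequence.IsRegular R rs},
    (rs.1.length : ℕ∞)

/-- An `R`-module is a `k`-vector space, `k` the residue field of `R`, if the maximal ideal
annihilates it, so that the action of `R` factors through `k`. -/
def IsResidueSpace (R : Type u) [CommRing R] [IsLocalRing R] (X : Type u) [AddCommGroup X]
    [Module R X] : Prop :=
  Module.IsTorsionBySet R X (maximalIdeal R : Set R)

/-- The `k`-vector space structure on a module annihilated by the maximal ideal, in which the class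
of `r` acts as `r`. -/
abbrev IsResidueSpace.module {R : Type u} [CommRing R] [IsLocalRing R] {X : Type u}
    [AddCommGroup X] [Module R X] (h : IsResidueSpace R X) : Module (ResidueField R) X :=
  Module.IsTorsionBySet.module (I := maximalIdeal R) h

/-- The dimension (a cardinal) over the residue field of a module annihilated by the maximal
ideal. -/
def IsResidueSpace.dim {R : Type u} [CommRing R] [IsLocalRing R] {X : Type u}
    [AddCommGroup X] [Module R X] (h : IsResidueSpace R X) : Cardinal.{u} :=
  @Module.rank (ResidueField R) X _ _ h.module

theorem isResidueSpace_ext_residueField (R : Type u) [CommRing R] [IsLocalRing R]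
    (M : ModuleCat.{u} R) (i : ℕ) :
    IsResidueSpace R (Ext (ModuleCat.of R (ResidueField R)) M i) := by
  intro x r
  have h0 : (r : R) • 𝟙 (ModuleCat.of R (ResidueField R)) = 0 := by
    refine ModuleCat.hom_ext (LinearMap.ext fun y => ?_)
    change (r : R) • (y : ResidueField R) = 0
    have hr : algebraMap R (ResidueField R) r = 0 := (residue_eq_zero_iff _).2 r.2
    rw [Algebra.smul_def, hr, zero_mul]
  have h : (r : R) • x = (Ext.mk₀ ((r : R) • 𝟙 (ModuleCat.of R (ResidueField R)))).comp x
      (zero_add i) := by simp [Ext.mk₀_smul]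
  exact h.trans (by simp [h0])

/-- The Bass number `μ_i(R) = dim_k Ext^i_R(k, R)`. (For Noetherian `R` this `Ext` is finitely
generated, so the dimension is finite and passing to a natural number loses nothing.) -/
def bassNumber (R : Type u) [CommRing R] [IsLocalRing R] (i : ℕ) : ℕ :=
  Cardinal.toNat (isResidueSpace_ext_residueField R (ModuleCat.of R R) i).dim

/-- The type of a local ring, `dim_k Ext^{depth R}_R(k, R)`. -/
def ringType (R : Type u) [CommRing R] [IsLocalRing R] : ℕ :=
  bassNumber R (depth R).toNat

end

end LocalSyzygy

/-! Write A = Ω^t k, r for the type, * for duality into R, and B for the image of P₀* → P₁*. Since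
Tr A = P₁*/B, Ext^{i+1}(Tr A, R) = Ext^i(B, R) for i > 0, while Ext¹(Tr A, R) = 0 because A is
torsionless. Everything rests on an exact sequence 0 → K → W → B → 0 (`exists_shortExact`) with K ≅
k^r, with Ext^i(W, R) = 0 for positive i ≠ t, and with Ext^t(W, R) → Ext^t(K, R) of one-dimensional
image, injective if t > 0. The long exact sequence then gives zero up to degree t + 1, dimension r·r
- 1 in degree t + 2, and Ext^{i-2}(K, R), of dimension r·μ_{i-2}, beyond.

For t > 0, W = Tr Ω^{t-1}k and K ≅ Ext¹(Ω^{t-1}k, R) ≅ Ext^t(k, R)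
(`nonempty_kerToImage_equiv_ext`). For j < t the positive Ext of Tr Ω^j k into R is k, in degree j +
1 only (`hasConcentratedExt`). The delicate point is that Ext^t(W, R) → Ext^t(K, R) is nonzero: the
induction on j also carries the fact that classes in Ext^{t-j-1}(k, Tr Ω^j k) are detected by
composition with Ext^{j+1}(Tr Ω^j k, R), and at j = t - 1 this applies to a line k ⊂ K ⊂ W. For t =
0, W = P₀*, K = k*, and the image is that of the evaluation k → k**. -/

namespace LocalSyzygy

/-! ### Comparison of quotients -/

section LinearAlgebra

variable {R : Type*} [CommRing R] {M N N' : Type*} [AddCommGroup M] [Module R M]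
  [AddCommGroup N] [Module R N] [AddCommGroup N'] [Module R N']

/-- Two surjections with the same kernel have isomorphic targets. -/
theorem nonempty_equiv_of_ker_eq (f : M →ₗ[R] N) (g : M →ₗ[R] N') (hf : Function.Surjective f)
    (hg : Function.Surjective g) (h : f.ker = g.ker) : Nonempty (N ≃ₗ[R] N') :=
  ⟨(f.quotKerEquivOfSurjective hf).symm.trans
    ((Submodule.quotEquivOfEq _ _ h).trans (g.quotKerEquivOfSurjective hg))⟩

end LinearAlgebra

variable {R : Type u} [CommRing R]

/-- The short exact sequence of modules given by linear maps. -/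
theorem shortExact_of_linearMap {A B C : ModuleCat.{u} R} (f : A →ₗ[R] B) (g : B →ₗ[R] C)
    (hf : Function.Injective f) (hfg : Function.Exact f g) (hg : Function.Surjective g) :
    (ShortComplex.mk (ModuleCat.ofHom f) (ModuleCat.ofHom g)
      (by ext x; exact hfg.apply_apply_eq_zero x)).ShortExact where
  exact := (ShortComplex.ShortExact.moduleCat_exact_iff_function_exact _).2 hfg
  mono_f := (ModuleCat.mono_iff_injective _).2 hf
  epi_g := (ModuleCat.epi_iff_surjective _).2 hg

/-! ### Long exact sequences and additivity of Ext -/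

section Ext

variable {S : ShortComplex (ModuleCat.{u} R)} (hS : S.ShortExact) (Y : ModuleCat.{u} R)

include hS in
-- The connecting map is onto because the next term vanishes. Keeping the cokernel allows n = 0,
-- where Ext of the middle term is a Hom and need not vanish.
theorem nonempty_ext_equiv_cokernel (n : ℕ) (h2 : Subsingleton (Ext S.X₂ Y (n + 1))) :
    Nonempty ((Ext S.X₁ Y n ⧸
      LinearMap.range ((Ext.mk₀ S.f).precompOfLinear R Y (zero_add n))) ≃ₗ[R]
      Ext S.X₃ Y (n + 1)) := by
  refine nonempty_equiv_of_ker_eq (Submodule.mkQ _)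
    (hS.extClass.precompOfLinear R Y (add_comm 1 n)) (Submodule.mkQ_surjective _) ?_ ?_
  · intro x
    exact Ext.contravariant_sequence_exact₃ hS Y x (Subsingleton.elim _ _) (add_comm 1 n)
  · rw [Submodule.ker_mkQ]
    ext x
    constructor
    · rintro ⟨y, rfl⟩
      exact hS.extClass_comp_assoc _ (h := add_comm 1 n)
    · intro hx
      exact Ext.contravariant_sequence_exact₁ hS Y x (add_comm 1 n) hx

include hS in
theorem nonempty_ext_equiv_shift (n : ℕ) (h1 : Subsingleton (Ext S.X₂ Y n))
    (h2 : Subsingleton (Ext S.X₂ Y (n + 1))) :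
    Nonempty (Ext S.X₁ Y n ≃ₗ[R] Ext S.X₃ Y (n + 1)) := by
  obtain ⟨e⟩ := nonempty_ext_equiv_cokernel hS Y n h2
  refine ⟨(Submodule.quotEquivOfEqBot _ ?_).symm.trans e⟩
  rw [eq_bot_iff]
  rintro _ ⟨y, rfl⟩
  rw [Subsingleton.elim y 0, map_zero]
  exact Submodule.zero_mem _

/-- `Ext` is a functor in its first argument. -/
noncomputable def extCongrLeft {A B : ModuleCat.{u} R} (e : A ≃ₗ[R] B) (n : ℕ) :
    Ext A Y n ≃ₗ[R] Ext B Y n :=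
  LinearEquiv.ofLinearMap
    ((Ext.mk₀ (ModuleCat.ofHom (e.symm : B →ₗ[R] A))).precompOfLinear R Y (zero_add n))
    ((Ext.mk₀ (ModuleCat.ofHom (e : A →ₗ[R] B))).precompOfLinear R Y (zero_add n))
    (by
      ext x
      simp [Ext.mk₀_comp_mk₀_assoc, ← ModuleCat.ofHom_comp])
    (by
      ext x
      simp [Ext.mk₀_comp_mk₀_assoc, ← ModuleCat.ofHom_comp])

/-- `Ext` turns finite powers in the first argument into finite powers. -/
theorem nonempty_ext_pi_equiv (X : ModuleCat.{u} R) (r n : ℕ) :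
    Nonempty (Ext (ModuleCat.of R (Fin r → X)) Y n ≃ₗ[R] (Fin r → Ext X Y n)) := by
  classical
  let p (i : Fin r) : ModuleCat.of R (Fin r → X) ⟶ X :=
    ModuleCat.ofHom (LinearMap.proj (R := R) (φ := fun _ => X) i)
  let s (i : Fin r) : X ⟶ ModuleCat.of R (Fin r → X) :=
    ModuleCat.ofHom (LinearMap.single R (fun _ => X) i)
  have hsp (i j : Fin r) : s i ≫ p j = if i = j then 𝟙 _ else 0 := by
    ext x
    by_cases h : i = j
    · subst h; simp [s, p]
    · simp [s, p, h, Ne.symm h]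
  have hps : ∑ i, p i ≫ s i = 𝟙 _ := by
    refine ModuleCat.hom_ext (LinearMap.ext fun x => funext fun j => ?_)
    simp [s, p, ModuleCat.hom_sum, Pi.single_apply]
  refine ⟨LinearEquiv.ofLinearMap
    (LinearMap.pi fun i => (Ext.mk₀ (s i)).precompOfLinear R Y (zero_add n))
    (∑ i, (Ext.mk₀ (p i)).precompOfLinear R Y (zero_add n) ∘ₗ LinearMap.proj i) ?_ ?_⟩
  · refine LinearMap.ext fun x => funext fun i => ?_
    simp only [LinearMap.comp_apply, LinearMap.pi_apply]
    simp [Ext.mk₀_comp_mk₀_assoc, hsp]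
    rw [Finset.sum_eq_single i]
    · simp
    · intro j _ hj
      simp [Ne.symm hj]
    · simp
  · refine LinearMap.ext fun x => ?_
    simp [Ext.mk₀_comp_mk₀_assoc]
    rw [← Ext.sum_comp, ← Ext.mk₀_sum, hps, Ext.mk₀_id_comp]

/-- A class in `Ext X Q n` with `Q` finitely generated projective is detected by the linear forms
on `Q`. -/
theorem ext_eq_zero_of_forall_form {X Q : ModuleCat.{u} R} [Module.Finite R Q]
    [Module.Projective R Q] {n : ℕ} (x : Ext X Q n)
    (hx : ∀ φ : Q ⟶ ModuleCat.of R R, x.comp (Ext.mk₀ φ) (add_zero n) = 0) : x = 0 := by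
  classical
  obtain ⟨m, f, g, -, -, hfg⟩ := Module.Finite.exists_comp_eq_id_of_projective R Q
  let p (i : Fin m) : Q ⟶ ModuleCat.of R R := ModuleCat.ofHom (LinearMap.proj i ∘ₗ g)
  let s (i : Fin m) : ModuleCat.of R R ⟶ Q :=
    ModuleCat.ofHom (f ∘ₗ LinearMap.single R (fun _ => R) i)
  have hps : ∑ i, p i ≫ s i = 𝟙 _ := by
    ext q
    have : f (g q) = q := LinearMap.congr_fun hfg q
    simp only [ModuleCat.hom_sum, p, s, ModuleCat.hom_comp, ModuleCat.hom_ofHom,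
      LinearMap.sum_apply, LinearMap.comp_apply, LinearMap.proj_apply, ← map_sum,
      LinearMap.coe_single, Finset.univ_sum_single, this]
    rfl
  rw [← Ext.comp_mk₀_id x, ← hps, Ext.mk₀_sum, Ext.comp_sum]
  refine Finset.sum_eq_zero fun i _ => ?_
  rw [← Ext.mk₀_comp_mk₀, ← Ext.comp_assoc x (Ext.mk₀ (p i)) (Ext.mk₀ (s i)) (add_zero n)
    (add_zero 0) (by simp), hx, Ext.zero_comp]

theorem subsingleton_ext_projective {X Q : ModuleCat.{u} R} [Module.Finite R Q]
    [Module.Projective R Q] {n : ℕ} (h : Subsingleton (Ext X (ModuleCat.of R R) n)) :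
    Subsingleton (Ext X Q n) :=
  subsingleton_of_forall_eq 0 fun x => ext_eq_zero_of_forall_form x fun _ => Subsingleton.elim _ _

theorem subsingleton_ext_of_module_projective (Q : ModuleCat.{u} R) [Module.Projective R Q]
    (n : ℕ) : Subsingleton (Ext Q Y (n + 1)) :=
  have : Projective Q := (IsProjective.iff_projective (R := R) Q).1 inferInstance
  Ext.subsingleton_of_projective Q Y n

end Ext

/-! ### Vector spaces over the residue field -/

section Dimension

variable {R : Type u} [CommRing R] [IsLocalRing R]

theorem isResidueSpace_of_equiv {X : Type u} [AddCommGroup X] [Module R X] {n : ℕ}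
    (e : X ≃ₗ[R] (Fin n → ResidueField R)) : IsResidueSpace R X := by
  intro x r
  apply e.injective
  rw [map_smul, map_zero]
  funext i
  rw [Pi.smul_apply, Algebra.smul_def, Pi.zero_apply,
    show algebraMap R (ResidueField R) r = 0 from (residue_eq_zero_iff _).2 r.2, zero_mul]

theorem algebraMap_residueField_surjective :
    Function.Surjective (algebraMap R (ResidueField R)) := residue_surjective

theorem IsResidueSpace.dim_eq {X : Type u} [AddCommGroup X] [Module R X]
    (h : IsResidueSpace R X) {n : ℕ} (e : X ≃ₗ[R] (Fin n → ResidueField R)) : h.dim = n := by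
  let := h.module
  have : IsScalarTower R (ResidueField R) X := Module.IsTorsionBySet.isScalarTower h
  have := (e.extendScalarsOfSurjective algebraMap_residueField_surjective).rank_eq
  rw [rank_fin_fun] at this
  exact this

theorem IsResidueSpace.nonempty_equiv {X : Type u} [AddCommGroup X] [Module R X]
    [Module.Finite R X] (h : IsResidueSpace R X) :
    Nonempty (X ≃ₗ[R] (Fin (Cardinal.toNat h.dim) → ResidueField R)) := by
  let := h.module
  have : IsScalarTower R (ResidueField R) X := Module.IsTorsionBySet.isScalarTower h
  have : Module.Finite (ResidueField R) X := Module.Finite.of_restrictScalars_finite R _ _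
  exact ⟨(Module.finBasis (ResidueField R) X).equivFun.restrictScalars R⟩

/-- The quotient of a vector space over the residue field by a line drops the dimension by one. -/
theorem dim_quotient_add_one {V E : Type u} [AddCommGroup V] [Module R V] [AddCommGroup E]
    [Module R E] {n : ℕ} (e : V ≃ₗ[R] (Fin n → ResidueField R)) (u : ResidueField R →ₗ[R] V)
    (hu : Function.Injective u) (q : (V ⧸ LinearMap.range u) ≃ₗ[R] E) :
    ∃ h : IsResidueSpace R E, h.dim + 1 = n := by
  have hV := isResidueSpace_of_equiv e
  have hE : IsResidueSpace R E := by
    intro x r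
    obtain ⟨y, rfl⟩ := q.surjective x
    obtain ⟨v, rfl⟩ := Submodule.mkQ_surjective _ y
    rw [← map_smul, ← map_smul, hV, map_zero, map_zero]
  let := hV.module
  have : IsScalarTower R (ResidueField R) V := Module.IsTorsionBySet.isScalarTower hV
  let := hE.module
  have : IsScalarTower R (ResidueField R) E := Module.IsTorsionBySet.isScalarTower hE
  let g : V →ₗ[ResidueField R] E := LinearMap.extendScalarsOfSurjective
    algebraMap_residueField_surjective (q.toLinearMap ∘ₗ Submodule.mkQ _)
  let u' : ResidueField R →ₗ[ResidueField R] V :=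
    u.extendScalarsOfSurjective algebraMap_residueField_surjective
  have hg : Function.Surjective g := q.surjective.comp (Submodule.mkQ_surjective _)
  have hker : g.ker = LinearMap.range u' := by
    ext v
    change q (Submodule.mkQ _ v) = 0 ↔ v ∈ LinearMap.range u
    rw [q.map_eq_zero_iff, Submodule.mkQ_apply, Submodule.Quotient.mk_eq_zero]
  have h1 := LinearMap.rank_range_add_rank_ker g
  rw [hker, ← (LinearEquiv.ofInjective u' hu).rank_eq, Module.rank_self,
    rank_range_of_surjective g hg] at h1
  exact ⟨hE, h1.trans (hV.dim_eq e)⟩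

/-- A linear map out of the residue field is zero or injective. -/
theorem injective_of_residueField {V : Type*} [AddCommGroup V] [Module R V]
    (u : ResidueField R →ₗ[R] V) (hu : u ≠ 0) : Function.Injective u := by
  have : IsSimpleModule R (ResidueField R) :=
    (isSimpleModule_iff_isCoatom (m := maximalIdeal R)).2 (maximalIdeal.isMaximal R).out
  exact (LinearMap.injective_or_eq_zero u).resolve_right hu

end Dimension

/-! ### Depth, Bass numbers and vanishing of Ext -/

section Rees

variable (R : Type u) [CommRing R] [IsNoetherianRing R] [IsLocalRing R]

/-- Rees' characterization of depth, transported along the identification of k with the shrunk copy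
of R/𝔪 in which the criterion is phrased. -/
theorem exists_isRegular_iff_subsingleton_ext (n : ℕ) :
    (∃ rs : List R, rs.length = n ∧ (∀ r ∈ rs, r ∈ maximalIdeal R) ∧
      RingTheory.Sequence.IsRegular R rs) ↔
    ∀ i < n, Subsingleton (Ext (ModuleCat.of R (ResidueField R)) (ModuleCat.of R R) i) := by
  have hlt : maximalIdeal R • (⊤ : Submodule R (ModuleCat.of R R)) < ⊤ := by
    have h : maximalIdeal R • (⊤ : Submodule R R) < ⊤ := by
      rw [smul_eq_mul, Ideal.mul_top, lt_top_iff_ne_top]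
      exact Ideal.IsPrime.ne_top'
    exact h
  have := (ModuleCat.exists_isRegular_tfae (maximalIdeal R) n (ModuleCat.of R R) hlt).out 1 3
  rw [← this]
  let e : ModuleCat.of R (Shrink.{u} (R ⧸ maximalIdeal R)) ≃ₗ[R]
    ModuleCat.of R (ResidueField R) := Shrink.linearEquiv R (R ⧸ maximalIdeal R)
  exact forall₂_congr fun i _ => (extCongrLeft _ e i).toEquiv.subsingleton_congr

variable {R} {t : ℕ} (ht : depth R = t)
include ht

theorem subsingleton_ext_of_lt_depth (i : ℕ) (hi : i < t) :
    Subsingleton (Ext (ModuleCat.of R (ResidueField R)) (ModuleCat.of R R) i) := by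
  by_contra hne
  have hle : depth R ≤ i := by
    refine iSup_le fun rs => ?_
    by_contra hlt
    have hlt : i < rs.1.length := by exact_mod_cast not_le.1 hlt
    exact hne ((exists_isRegular_iff_subsingleton_ext R _).1 ⟨rs.1, rfl, rs.2.1, rs.2.2⟩ i hlt)
  rw [ht] at hle
  exact absurd (by exact_mod_cast hle) (not_le.2 hi)

theorem nontrivial_ext_depth :
    Nontrivial (Ext (ModuleCat.of R (ResidueField R)) (ModuleCat.of R R) t) := by
  by_contra hne
  rw [not_nontrivial_iff_subsingleton] at hne
  -- Vanishing in degree t as well would produce a regular sequence of length t + 1.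
  obtain ⟨rs, hl, hm, hr⟩ := (exists_isRegular_iff_subsingleton_ext R (t + 1)).2 (by
    intro i hi
    rcases Nat.lt_succ_iff_lt_or_eq.1 hi with hi | rfl
    · exact subsingleton_ext_of_lt_depth ht i hi
    · exact hne)
  have : ((t + 1 : ℕ) : ℕ∞) ≤ depth R := by
    rw [← hl]
    exact le_iSup (fun rs : {rs : List R // (∀ r ∈ rs, r ∈ maximalIdeal R) ∧
      RingTheory.Sequence.IsRegular R rs} => (rs.1.length : ℕ∞)) ⟨rs, hm, hr⟩
  rw [ht] at this
  have : t + 1 ≤ t := by exact_mod_cast this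
  omega

omit [IsNoetherianRing R] in
theorem ringType_eq : ringType R = bassNumber R t := by
  rw [ringType, ht]
  rfl

omit ht in
theorem nonempty_ext_equiv_bassNumber (i : ℕ) :
    Nonempty (Ext (ModuleCat.of R (ResidueField R)) (ModuleCat.of R R) i ≃ₗ[R]
      (Fin (bassNumber R i) → ResidueField R)) :=
  have : Module.Finite R (ModuleCat.of R (ResidueField R)) :=
    inferInstanceAs (Module.Finite R (R ⧸ maximalIdeal R))
  have : Module.Finite R (ModuleCat.of R R) := inferInstanceAs (Module.Finite R R)
  (isResidueSpace_ext_residueField R (ModuleCat.of R R) i).nonempty_equiv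

theorem ringType_pos : 0 < ringType R := by
  obtain ⟨e⟩ := nonempty_ext_equiv_bassNumber (R := R) t
  have := nontrivial_ext_depth ht
  rw [ringType_eq ht]
  refine Nat.pos_of_ne_zero fun h0 => ?_
  rw [h0] at e
  exact not_subsingleton _ e.toEquiv.subsingleton

omit ht in
/-- The `Ext` modules of a finite-dimensional vector space over the residue field. -/
theorem nonempty_ext_equiv_of_equiv_pi {K : ModuleCat.{u} R} {r : ℕ}
    (e : K ≃ₗ[R] (Fin r → ResidueField R)) (i : ℕ) :
    Nonempty (Ext K (ModuleCat.of R R) i ≃ₗ[R] (Fin (r * bassNumber R i) → ResidueField R)) := by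
  obtain ⟨e₁⟩ := nonempty_ext_pi_equiv (ModuleCat.of R R) (ModuleCat.of R (ResidueField R)) r i
  obtain ⟨e₂⟩ := nonempty_ext_equiv_bassNumber (R := R) i
  let e' : K ≃ₗ[R] ModuleCat.of R (Fin r → ModuleCat.of R (ResidueField R)) := e
  exact ⟨(extCongrLeft _ e' i).trans (e₁.trans ((LinearEquiv.piCongrRight fun _ => e₂).trans
    ((LinearEquiv.curry R (ResidueField R) _ _).symm.trans
      (LinearEquiv.funCongrLeft R (ResidueField R) finProdFinEquiv.symm))))⟩

end Rees

variable {R : Type u} [CommRing R]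

attribute [instance] ProjPresentation.finite₁ ProjPresentation.finite₀
  ProjPresentation.projective₁ ProjPresentation.projective₀

theorem dualMap_apply_comp {P Q A : Type*} [AddCommGroup P] [Module R P] [AddCommGroup Q]
    [Module R Q] [AddCommGroup A] [Module R A] {d : P →ₗ[R] Q} {aug : Q →ₗ[R] A}
    (h : Function.Exact d aug) (ψ : Module.Dual R A) : d.dualMap (aug.dualMap ψ) = 0 := by
  ext p
  simp [h.apply_apply_eq_zero]

/-! ### Kernel of the map from a quotient onto an image -/

section QuotToRange

variable {L M N : Type*} [AddCommGroup L] [Module R L] [AddCommGroup M] [Module R M]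
  [AddCommGroup N] [Module R N]

/-- The map from a quotient by a submodule of the kernel to the image. -/
def quotToRange (δ : M →ₗ[R] N) (U : Submodule R M) (h : U ≤ LinearMap.ker δ) :
    (M ⧸ U) →ₗ[R] LinearMap.range δ :=
  U.liftQ δ.rangeRestrict (by rwa [LinearMap.ker_rangeRestrict])

theorem quotToRange_surjective (δ : M →ₗ[R] N) (U : Submodule R M) (h : U ≤ LinearMap.ker δ) :
    Function.Surjective (quotToRange δ U h) := by
  rintro ⟨_, ξ, rfl⟩
  exact ⟨U.mkQ ξ, rfl⟩

/-- A map onto the kernel of `δ` induces a map onto the kernel of `quotToRange`. -/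
def toKerQuotToRange {δ : M →ₗ[R] N} {α : L →ₗ[R] M} (hα : Function.Exact α δ)
    (U : Submodule R M) (h : U ≤ LinearMap.ker δ) : L →ₗ[R] LinearMap.ker (quotToRange δ U h) :=
  LinearMap.codRestrict _ (U.mkQ ∘ₗ α) (fun x => by
    rw [LinearMap.mem_ker]
    exact Subtype.ext (hα.apply_apply_eq_zero x))

variable {δ : M →ₗ[R] N} {α : L →ₗ[R] M} (hα : Function.Exact α δ) (U : Submodule R M)
  (h : U ≤ LinearMap.ker δ)

theorem toKerQuotToRange_surjective : Function.Surjective (toKerQuotToRange hα U h) := by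
  rintro ⟨w, hw⟩
  obtain ⟨ξ, rfl⟩ := U.mkQ_surjective w
  obtain ⟨x, rfl⟩ := (hα ξ).1 (congrArg Subtype.val (LinearMap.mem_ker.1 hw))
  exact ⟨x, rfl⟩

theorem toKerQuotToRange_eq_zero_iff (x : L) : toKerQuotToRange hα U h x = 0 ↔ α x ∈ U := by
  rw [← Subtype.coe_inj]
  change Submodule.Quotient.mk (α x) = 0 ↔ _
  rw [Submodule.Quotient.mk_eq_zero]

end QuotToRange

theorem exact_dualMap {P Q A : Type*} [AddCommGroup P] [Module R P] [AddCommGroup Q]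
    [Module R Q] [AddCommGroup A] [Module R A] {d : P →ₗ[R] Q} {aug : Q →ₗ[R] A}
    (h : Function.Exact d aug) (hs : Function.Surjective aug) :
    Function.Exact aug.dualMap d.dualMap := by
  intro ξ
  refine ⟨fun hξ => ?_, ?_⟩
  · have hker : LinearMap.ker aug ≤ LinearMap.ker ξ := by
      intro p hp
      obtain ⟨q, rfl⟩ := (h p).1 hp
      exact LinearMap.congr_fun hξ q
    refine ⟨((LinearMap.ker aug).liftQ ξ hker) ∘ₗ
      (aug.quotKerEquivOfSurjective hs).symm.toLinearMap, ?_⟩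
    ext p
    have : (aug.quotKerEquivOfSurjective hs).symm (aug p) =
        Submodule.mkQ (LinearMap.ker aug) p := by
      rw [LinearEquiv.symm_apply_eq]
      rfl
    simp [this]
  · rintro ⟨ψ, rfl⟩
    exact dualMap_apply_comp h ψ

/-! ### Transposes, and presentations spliced with a syzygy -/

namespace ProjPresentation

variable {A : ModuleCat.{u} R} (π : ProjPresentation R A)

/-- The Auslander transpose computed from a presentation. -/
abbrev transpose : ModuleCat.{u} R :=
  ModuleCat.of R (Module.Dual R π.P₁ ⧸ LinearMap.range π.d.dualMap)

/-- The dual of the module of generators. -/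
abbrev dual₀ : ModuleCat.{u} R := ModuleCat.of R (Module.Dual R π.P₀)

/-- The dual of the module of relations. -/
abbrev dual₁ : ModuleCat.{u} R := ModuleCat.of R (Module.Dual R π.P₁)

/-- The dual of the differential. -/
abbrev dualDiff : π.dual₀ →ₗ[R] π.dual₁ := π.d.dualMap

/-- The image of the dual of the differential. -/
abbrev image : ModuleCat.{u} R := ModuleCat.of R (LinearMap.range π.dualDiff)

theorem shortExact_image : (ShortComplex.mk (X₁ := π.image) (X₂ := π.dual₁) (X₃ := π.transpose)
    (ModuleCat.ofHom (Submodule.subtype _)) (ModuleCat.ofHom (Submodule.mkQ _))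
    (by ext1; exact (LinearMap.exact_subtype_mkQ _).linearMap_comp_eq_zero)).ShortExact :=
  shortExact_of_linearMap (A := π.image) (B := π.dual₁) (C := π.transpose)
    (Submodule.subtype _) (Submodule.mkQ _) (Submodule.subtype_injective _)
    (LinearMap.exact_subtype_mkQ _) (Submodule.mkQ_surjective _)

/-- A linear form on the image of `P₀* → P₁*` killing the dual of `A` is the evaluation at an
element of `P₁`, if `A` is torsionless. -/
theorem exists_eval_of_form (hA : ∀ a : A, (∀ ψ : Module.Dual R A, ψ a = 0) → a = 0)
    (φ : LinearMap.range π.dualDiff →ₗ[R] R) :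
    ∃ q : π.P₁, ∀ z, φ z = z.1 q := by
  -- P₀ is reflexive, so the form pulled back to P₀* is evaluation at some p. It kills A*, so p dies
  -- in the torsionless module A and lifts to P₁.
  obtain ⟨p, hp⟩ := (Module.evalEquiv R π.P₀).surjective (φ ∘ₗ π.dualDiff.rangeRestrict)
  have hp (ξ : Module.Dual R π.P₀) : ξ p = φ (π.dualDiff.rangeRestrict ξ) :=
    LinearMap.congr_fun hp ξ
  have h0 : π.aug p = 0 := by
    refine hA _ fun ψ => ?_
    have h1 := hp (π.aug.dualMap ψ)
    rw [show π.dualDiff.rangeRestrict (π.aug.dualMap ψ) = 0 from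
      Subtype.ext (dualMap_apply_comp π.exact ψ), map_zero] at h1
    exact h1
  obtain ⟨q, rfl⟩ := (π.exact p).1 h0
  refine ⟨q, ?_⟩
  rintro ⟨_, ξ, rfl⟩
  exact (hp ξ).symm

/-- Ext¹ of the transpose is the obstruction to extending forms from the image to P₁*; evaluation at
an element of P₁ is such an extension. -/
theorem subsingleton_ext_one_transpose
    (hA : ∀ a : A, (∀ ψ : Module.Dual R A, ψ a = 0) → a = 0) :
    Subsingleton (Ext π.transpose (ModuleCat.of R R) 1) := by
  obtain ⟨e⟩ := nonempty_ext_equiv_cokernel π.shortExact_image (ModuleCat.of R R) 0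
    (subsingleton_ext_of_module_projective _ π.dual₁ 0)
  refine (e.toEquiv.subsingleton_congr).1 ?_
  rw [Submodule.Quotient.subsingleton_iff, eq_top_iff]
  intro x _
  obtain ⟨φ, rfl⟩ := Ext.linearEquiv₀ (R := R).symm.surjective x
  obtain ⟨q, hq⟩ := π.exists_eval_of_form hA φ.hom
  refine ⟨Ext.mk₀ (ModuleCat.ofHom (Module.Dual.eval R π.P₁ q)), ?_⟩
  simp only [Ext.bilinearCompOfLinear_apply_apply, Ext.mk₀_comp_mk₀, Ext.linearEquiv₀_symm_apply]
  congr 1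
  ext z
  exact (hq z).symm

theorem subsingleton_ext_dual₀ (Y : ModuleCat.{u} R) (n : ℕ) :
    Subsingleton (Ext π.dual₀ Y (n + 1)) :=
  subsingleton_ext_of_module_projective Y π.dual₀ n

theorem subsingleton_ext_dual₁ (Y : ModuleCat.{u} R) (n : ℕ) :
    Subsingleton (Ext π.dual₁ Y (n + 1)) :=
  subsingleton_ext_of_module_projective Y π.dual₁ n

theorem nonempty_ext_transpose_equiv_image (n : ℕ) (hn : 0 < n) :
    Nonempty (Ext π.image (ModuleCat.of R R) n ≃ₗ[R]
      Ext π.transpose (ModuleCat.of R R) (n + 1)) := by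
  obtain ⟨n, rfl⟩ := Nat.exists_eq_add_of_lt hn
  rw [zero_add]
  exact nonempty_ext_equiv_shift π.shortExact_image _ _ (π.subsingleton_ext_dual₁ _ _)
    (π.subsingleton_ext_dual₁ _ _)

section Splice

variable {X : ModuleCat.{u} R} (ρ : ProjPresentation R X) (e : A ≃ₗ[R] LinearMap.range ρ.d)

/-- The inclusion of a syzygy. -/
def incl : A →ₗ[R] ρ.P₀ := Submodule.subtype _ ∘ₗ e.toLinearMap

theorem incl_injective : Function.Injective (ρ.incl e) :=
  (Submodule.subtype_injective _).comp e.injective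

theorem range_incl : LinearMap.range (ρ.incl e) = LinearMap.range ρ.d := by
  rw [incl, LinearMap.range_comp, LinearEquiv.range, Submodule.map_top, Submodule.range_subtype]

theorem exact_incl : Function.Exact (ρ.incl e) ρ.aug := by
  rw [LinearMap.exact_iff, range_incl]
  exact LinearMap.exact_iff.1 ρ.exact

theorem shortExact_incl : (ShortComplex.mk (X₁ := A) (X₂ := ρ.P₀) (X₃ := X)
    (ModuleCat.ofHom (ρ.incl e)) (ModuleCat.ofHom ρ.aug)
    (by ext x; exact (ρ.exact_incl e).apply_apply_eq_zero x)).ShortExact :=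
  shortExact_of_linearMap _ _ (ρ.incl_injective e) (ρ.exact_incl e) ρ.surjective

/-- A presentation of the first syzygy induces one of the module. -/
abbrev splice : ProjPresentation R X where
  P₁ := π.P₀
  P₀ := ρ.P₀
  finite₁ := π.finite₀
  finite₀ := ρ.finite₀
  projective₁ := π.projective₀
  projective₀ := ρ.projective₀
  d := ρ.incl e ∘ₗ π.aug
  aug := ρ.aug
  exact := by
    rw [LinearMap.exact_iff, LinearMap.range_comp, LinearMap.range_eq_top.2 π.surjective,
      Submodule.map_top, ← LinearMap.exact_iff]
    exact ρ.exact_incl e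
  surjective := ρ.surjective

include ρ e in
theorem torsionless_of_incl (a : A) (ha : ∀ ψ : Module.Dual R A, ψ a = 0) : a = 0 := by
  apply ρ.incl_injective e
  rw [map_zero]
  exact (Module.forall_dual_apply_eq_zero_iff R _).1 fun φ => ha (φ ∘ₗ ρ.incl e)

theorem range_dualMap_splice_le :
    (LinearMap.range (π.splice ρ e).d.dualMap : Submodule R π.dual₀) ≤
      LinearMap.ker π.dualDiff := by
  rintro _ ⟨η, rfl⟩
  exact dualMap_apply_comp π.exact (η ∘ₗ ρ.incl e)

/-- The map from the transpose of a module to the dual of the relations of its syzygy. -/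
def toImage : (π.splice ρ e).transpose ⟶ π.image :=
  ModuleCat.ofHom (quotToRange π.dualDiff _ (π.range_dualMap_splice_le ρ e))

theorem toImage_surjective : Function.Surjective (π.toImage ρ e).hom :=
  quotToRange_surjective _ _ (π.range_dualMap_splice_le ρ e)

/-- The kernel of the map from the transpose of a module to the dual of the relations of its
syzygy. -/
abbrev kerToImage : ModuleCat.{u} R := ModuleCat.of R (LinearMap.ker (π.toImage ρ e).hom)

theorem shortExact_kerToImage :
    (ShortComplex.mk (X₁ := π.kerToImage ρ e) (X₂ := (π.splice ρ e).transpose) (X₃ := π.image)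
      (ModuleCat.ofHom (Submodule.subtype _)) (π.toImage ρ e)
      (by ext1; exact LinearMap.ext fun x => x.2)).ShortExact :=
  LinearMap.shortExact_shortComplexKer (π.toImage_surjective ρ e)

/-- The map from the dual of a syzygy to the transpose. -/
def dualToKer : Module.Dual R A →ₗ[R] π.kerToImage ρ e :=
  toKerQuotToRange (L := Module.Dual R A) (M := π.dual₀) (exact_dualMap π.exact π.surjective)
      _ (π.range_dualMap_splice_le ρ e)

theorem dualToKer_surjective : Function.Surjective (π.dualToKer ρ e) :=
  toKerQuotToRange_surjective _ _ (π.range_dualMap_splice_le ρ e)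

theorem dualToKer_eq_zero_iff (ψ : Module.Dual R A) :
    π.dualToKer ρ e ψ = 0 ↔ ∃ η : Module.Dual R ρ.P₀, η ∘ₗ ρ.incl e = ψ := by
  refine (toKerQuotToRange_eq_zero_iff _ _ (π.range_dualMap_splice_le ρ e) _).trans ?_
  constructor
  · rintro ⟨η, hη⟩
    refine ⟨η, LinearMap.ext fun a => ?_⟩
    obtain ⟨p, rfl⟩ := π.surjective a
    exact LinearMap.congr_fun hη p
  · rintro ⟨η, rfl⟩
    exact ⟨η, rfl⟩

/-- Both sides are A* modulo the forms that extend to the projective module containing the syzygy A: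
the left by exactness of A* → P₀* → P₁*, the right by the long exact sequence of X. -/
theorem nonempty_kerToImage_equiv_ext :
    Nonempty (π.kerToImage ρ e ≃ₗ[R] Ext X (ModuleCat.of R R) 1) := by
  let l : Module.Dual R A ≃ₗ[R] Ext A (ModuleCat.of R R) 0 :=
    (ModuleCat.homLinearEquiv (S := R) (M := A) (N := ModuleCat.of R R)).symm.trans
      (Ext.linearEquiv₀ (R := R)).symm
  have hl (ψ : Module.Dual R A) : l ψ = Ext.mk₀ (ModuleCat.ofHom ψ) := rfl
  refine nonempty_equiv_of_ker_eq (π.dualToKer ρ e)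
    (((ρ.shortExact_incl e).extClass.precompOfLinear R (ModuleCat.of R R) (add_zero 1)) ∘ₗ
      l.toLinearMap) (π.dualToKer_surjective ρ e) ?_ ?_
  · refine Function.Surjective.comp (g := (ρ.shortExact_incl e).extClass.precompOfLinear R
      (ModuleCat.of R R) (add_zero 1)) (fun x => ?_) l.surjective
    exact Ext.contravariant_sequence_exact₃ (ρ.shortExact_incl e) (ModuleCat.of R R) x
      (@Subsingleton.elim _ (subsingleton_ext_of_module_projective _ ρ.P₀ 0) _ _) (add_zero 1)
  · ext ψ
    rw [LinearMap.mem_ker, dualToKer_eq_zero_iff, LinearMap.mem_ker]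
    change _ ↔ (ρ.shortExact_incl e).extClass.comp (l ψ) (add_zero 1) = 0
    constructor
    · rintro ⟨η, rfl⟩
      have h := (ρ.shortExact_incl e).extClass_comp_assoc (Ext.mk₀ (ModuleCat.ofHom η))
        (h := add_zero 1)
      rwa [Ext.mk₀_comp_mk₀] at h
    · intro h
      obtain ⟨y, hy⟩ := Ext.contravariant_sequence_exact₁ (ρ.shortExact_incl e)
        (ModuleCat.of R R) (l ψ) (add_zero 1) h
      obtain ⟨η, rfl⟩ := (Ext.linearEquiv₀ (R := R)).symm.surjective y
      refine ⟨η.hom, ?_⟩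
      rw [hl, Ext.linearEquiv₀_symm_apply, Ext.mk₀_comp_mk₀] at hy
      exact congrArg ModuleCat.Hom.hom (Ext.homEquiv₀.symm.injective hy)

end Splice

end ProjPresentation

/-- `Ext` of a syzygy by dimension shifting. -/
theorem IsNthSyzygy.nonempty_ext_equiv {M : ModuleCat.{u} R} (Y : ModuleCat.{u} R) :
    ∀ {n : ℕ} {S : ModuleCat.{u} R}, IsNthSyzygy R n M S → ∀ i : ℕ, 0 < i →
      Nonempty (Ext S Y i ≃ₗ[R] Ext M Y (i + n))
  | 0, _, ⟨e⟩, i, _ => ⟨extCongrLeft Y e i⟩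
  | n + 1, S, ⟨L, hL, ρ, ⟨e⟩⟩, i, hi => by
    obtain ⟨e₁⟩ := hL.nonempty_ext_equiv Y (i + 1) i.succ_pos
    obtain ⟨j, rfl⟩ := Nat.exists_eq_add_of_lt hi
    obtain ⟨e₂⟩ := nonempty_ext_equiv_shift (ρ.shortExact_incl e) Y (0 + j + 1)
      (subsingleton_ext_of_module_projective Y ρ.P₀ _)
      (subsingleton_ext_of_module_projective Y ρ.P₀ _)
    rw [show 0 + j + 1 + (n + 1) = 0 + j + 1 + 1 + n by omega]
    exact ⟨e₂.trans e₁⟩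

/-! ### Concentrated cohomology of transposes of syzygies of k -/

variable {R : Type u} [CommRing R] [IsLocalRing R]

/-- The cohomology of a transpose of a `j`-th syzygy of the residue field, for `j` less than the
depth `t`: it is concentrated in degree `j + 1`, where it is one-dimensional and detects the classes
of `Ext^(t - j - 1)(k, T)`. -/
structure HasConcentratedExt (t j : ℕ) (T : ModuleCat.{u} R) : Prop where
  subsingleton : ∀ i, 0 < i → i ≠ j + 1 → Subsingleton (Ext T (ModuleCat.of R R) i)
  nonempty_equiv : Nonempty (ResidueField R ≃ₗ[R] Ext T (ModuleCat.of R R) (j + 1))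
  exists_comp_ne_zero : ∀ (m : ℕ) (hm : m + (j + 1) = t)
    (g : Ext (ModuleCat.of R (ResidueField R)) T m), g ≠ 0 →
      ∃ e : Ext T (ModuleCat.of R R) (j + 1), g.comp e hm ≠ 0

/-- Dimension shifting raises every degree by one, starting from degree 2; degree 1 is therefore a
separate hypothesis. Detection passes through the connecting map on Ext(k, -), injective below t. -/
theorem HasConcentratedExt.of_shortExact {t j : ℕ} {S : ShortComplex (ModuleCat.{u} R)}
    (hS : S.ShortExact) (h₂ : ∀ n, Subsingleton (Ext S.X₂ (ModuleCat.of R R) (n + 1)))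
    (hk : ∀ m < t, Subsingleton (Ext (ModuleCat.of R (ResidueField R)) S.X₂ m))
    (h₃ : Subsingleton (Ext S.X₃ (ModuleCat.of R R) 1)) (h : HasConcentratedExt t j S.X₁) :
    HasConcentratedExt t (j + 1) S.X₃ where
  subsingleton i hi hij := by
    obtain ⟨i, rfl⟩ := Nat.exists_eq_add_of_lt hi
    rw [zero_add] at hij ⊢
    rcases i with - | i
    · exact h₃
    · obtain ⟨e⟩ := nonempty_ext_equiv_shift hS (ModuleCat.of R R) (i + 1) (h₂ _) (h₂ _)
      have := h.subsingleton (i + 1) i.succ_pos (by omega)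
      exact e.symm.toEquiv.subsingleton
  nonempty_equiv := by
    obtain ⟨e⟩ := nonempty_ext_equiv_shift hS (ModuleCat.of R R) (j + 1) (h₂ _) (h₂ _)
    obtain ⟨e'⟩ := h.nonempty_equiv
    exact ⟨e'.trans e⟩
  exists_comp_ne_zero m hm g hg := by
    have hδ : g.comp hS.extClass rfl ≠ 0 := by
      intro h0
      obtain ⟨x, rfl⟩ := Ext.covariant_sequence_exact₃ _ hS g rfl h0
      have := hk m (by omega)
      rw [Subsingleton.elim x 0, Ext.zero_comp] at hg
      exact hg rfl
    obtain ⟨e, he⟩ := h.exists_comp_ne_zero (m + 1) (by omega) _ hδ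
    -- By associativity, composing g with this product is composing the boundary of g with `e`.
    refine ⟨hS.extClass.comp e (add_comm 1 (j + 1)), ?_⟩
    rwa [← Ext.comp_assoc g hS.extClass e rfl (add_comm 1 (j + 1)) (by omega)]

namespace ProjPresentation

variable {A : ModuleCat.{u} R} (π : ProjPresentation R A) {t : ℕ}

section

variable (ht : ∀ i < t,
  Subsingleton (Ext (ModuleCat.of R (ResidueField R)) (ModuleCat.of R R) i))

omit [IsLocalRing R] in
theorem shortExact_dual [hA : Subsingleton (Module.Dual R A)] :
    (ShortComplex.mk (X₁ := π.dual₀) (X₂ := π.dual₁) (X₃ := π.transpose)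
      (ModuleCat.ofHom π.dualDiff) (ModuleCat.ofHom (Submodule.mkQ _))
      (by ext1; exact (LinearMap.exact_map_mkQ_range _).linearMap_comp_eq_zero)).ShortExact := by
  refine shortExact_of_linearMap (A := π.dual₀) (B := π.dual₁) (C := π.transpose)
    π.dualDiff (Submodule.mkQ _) ?_ (LinearMap.exact_map_mkQ_range _) (Submodule.mkQ_surjective _)
  rw [injective_iff_map_eq_zero]
  intro ξ hξ
  obtain ⟨ψ, rfl⟩ := (exact_dualMap π.exact π.surjective ξ).1 hξ
  rw [Subsingleton.elim ψ 0, map_zero]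

omit [IsLocalRing R] in
/-- If `A* = 0`, then `A` is `Ext¹` of its transpose. -/
theorem nonempty_equiv_ext_transpose [hA : Subsingleton (Module.Dual R A)] :
    Nonempty (A ≃ₗ[R] Ext π.transpose (ModuleCat.of R R) 1) := by
  have hS := π.shortExact_dual
  let l : π.P₀ ≃ₗ[R] Ext π.dual₀ (ModuleCat.of R R) 0 :=
    (Module.evalEquiv R π.P₀).trans
      ((ModuleCat.homLinearEquiv (S := R) (M := π.dual₀) (N := ModuleCat.of R R)).symm.trans
        (Ext.linearEquiv₀ (R := R)).symm)
  have hl (p : π.P₀) : l p = Ext.mk₀ (ModuleCat.ofHom (Module.Dual.eval R π.P₀ p)) := rfl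
  refine nonempty_equiv_of_ker_eq π.aug
    ((hS.extClass.precompOfLinear R (ModuleCat.of R R) (add_zero 1)) ∘ₗ l.toLinearMap)
    π.surjective ?_ ?_
  · refine Function.Surjective.comp (g := hS.extClass.precompOfLinear R
      (ModuleCat.of R R) (add_zero 1)) (fun x => ?_) l.surjective
    exact Ext.contravariant_sequence_exact₃ hS (ModuleCat.of R R) x
      (@Subsingleton.elim _ (π.subsingleton_ext_dual₁ _ 0) _ _) (add_zero 1)
  · ext p
    rw [LinearMap.mem_ker, LinearMap.mem_ker]
    change _ ↔ hS.extClass.comp (l p) (add_zero 1) = 0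
    refine (π.exact p).trans ?_
    constructor
    · rintro ⟨q, rfl⟩
      have h := hS.extClass_comp_assoc
        (Ext.mk₀ (ModuleCat.ofHom (Module.Dual.eval R π.P₁ q)) :
          Ext π.dual₁ (ModuleCat.of R R) 0) (h := add_zero 1)
      rwa [Ext.mk₀_comp_mk₀] at h
    · intro h
      obtain ⟨y, hy⟩ := Ext.contravariant_sequence_exact₁ hS (ModuleCat.of R R) (l p)
        (add_zero 1) h
      obtain ⟨η, rfl⟩ := (Ext.linearEquiv₀ (R := R)).symm.surjective y
      obtain ⟨q, hq⟩ := (Module.evalEquiv R π.P₁).surjective η.hom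
      refine ⟨q, (Module.evalEquiv R π.P₀).injective ?_⟩
      rw [hl, Ext.linearEquiv₀_symm_apply, Ext.mk₀_comp_mk₀] at hy
      have := congrArg ModuleCat.Hom.hom (Ext.homEquiv₀.symm.injective hy)
      refine Eq.trans ?_ this
      rw [ModuleCat.hom_comp, ← hq]
      rfl

include ht

theorem subsingleton_ext_residueField_dual₁ (i : ℕ) (hi : i < t) :
    Subsingleton (Ext (ModuleCat.of R (ResidueField R)) π.dual₁ i) :=
  subsingleton_ext_projective (ht i hi)

/-- As t > 0, k* = 0, so 0 → P₀* → P₁* → Tr k → 0 is a projective resolution, and dualizing it back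
gives k in degree 1. -/
theorem hasConcentratedExt_zero (ht₀ : 0 < t) (e : A ≃ₗ[R] ResidueField R) :
    HasConcentratedExt t 0 π.transpose := by
  have hA : Subsingleton (Module.Dual R A) := by
    have := ht 0 ht₀
    let l : Ext (ModuleCat.of R (ResidueField R)) (ModuleCat.of R R) 0 ≃ₗ[R]
        (ModuleCat.of R (ResidueField R) →ₗ[R] ModuleCat.of R R) :=
      (Ext.linearEquiv₀ (R := R)).trans (ModuleCat.homLinearEquiv (S := R))
    have : Subsingleton (Module.Dual R (ResidueField R)) := l.symm.toEquiv.subsingleton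
    exact e.symm.dualMap.toEquiv.subsingleton
  have hS := π.shortExact_dual
  refine ⟨fun i hi hi1 => ?_, ?_, fun m hm g hg => ?_⟩
  · obtain ⟨i, rfl⟩ : ∃ n, i = n + 1 + 1 := ⟨i - 2, by omega⟩
    obtain ⟨e⟩ := nonempty_ext_equiv_shift hS (ModuleCat.of R R) (i + 1)
      (π.subsingleton_ext_dual₁ _ _) (π.subsingleton_ext_dual₁ _ _)
    have := π.subsingleton_ext_dual₀ (ModuleCat.of R R) i
    exact e.symm.toEquiv.subsingleton
  · obtain ⟨e'⟩ := π.nonempty_equiv_ext_transpose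
    exact ⟨e.symm.trans e'⟩
  · have hδ : g.comp hS.extClass rfl ≠ 0 := by
      intro h0
      obtain ⟨x, rfl⟩ := Ext.covariant_sequence_exact₃ _ hS g rfl h0
      have := π.subsingleton_ext_residueField_dual₁ ht m (by omega)
      rw [@Subsingleton.elim _ this x 0, Ext.zero_comp] at hg
      exact hg rfl
    -- The boundary of g is a nonzero class with coefficients in the projective P₀*, so some linear
    -- form detects it.
    have : ∃ φ : π.dual₀ ⟶ ModuleCat.of R R,
        (g.comp hS.extClass rfl).comp (Ext.mk₀ φ) (add_zero _) ≠ 0 := by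
      by_contra! hφ
      exact hδ (ext_eq_zero_of_forall_form (Q := π.dual₀) _ hφ)
    obtain ⟨φ, hφ⟩ := this
    refine ⟨hS.extClass.comp (Ext.mk₀ φ) (add_zero 1), ?_⟩
    rw [← Ext.comp_assoc g hS.extClass (Ext.mk₀ φ) rfl (add_zero 1) (by omega)]
    subst hm
    exact hφ

/-- When Ext¹(X, R) = 0, the transpose of X maps isomorphically onto the image of P₀* → P₁*, so it
is a syzygy of the transpose of A. -/
theorem hasConcentratedExt_succ {X : ModuleCat.{u} R} (ρ : ProjPresentation R X)
    (e : A ≃ₗ[R] LinearMap.range ρ.d) {j : ℕ}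
    (hX : Subsingleton (Ext X (ModuleCat.of R R) 1))
    (h : HasConcentratedExt t j (π.splice ρ e).transpose) :
    HasConcentratedExt t (j + 1) π.transpose := by
  have hinj : Function.Injective (π.toImage ρ e).hom := by
    rw [← LinearMap.ker_eq_bot]
    obtain ⟨e'⟩ := π.nonempty_kerToImage_equiv_ext ρ e
    have : Subsingleton (LinearMap.ker (π.toImage ρ e).hom) := e'.toEquiv.subsingleton
    exact Submodule.eq_bot_of_subsingleton
  let f : (π.splice ρ e).transpose →ₗ[R] π.dual₁ :=
    (LinearMap.range π.dualDiff).subtype ∘ₗ (π.toImage ρ e).hom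
  have hf : LinearMap.range f = LinearMap.range π.dualDiff := by
    rw [LinearMap.range_comp, LinearMap.range_eq_top.2 (π.toImage_surjective ρ e),
      Submodule.map_top, Submodule.range_subtype]
  let g : π.dual₁ →ₗ[R] π.transpose := Submodule.mkQ _
  have hfg : Function.Exact f g := by
    rw [LinearMap.exact_iff, hf]
    exact Submodule.ker_mkQ _
  exact HasConcentratedExt.of_shortExact
    (shortExact_of_linearMap f g ((Submodule.subtype_injective _).comp hinj) hfg
      (Submodule.mkQ_surjective _)) (π.subsingleton_ext_dual₁ _)
    (π.subsingleton_ext_residueField_dual₁ ht)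
    (π.subsingleton_ext_one_transpose (ρ.torsionless_of_incl e)) h

theorem hasConcentratedExt (j : ℕ) : ∀ {A : ModuleCat.{u} R} (π : ProjPresentation R A),
    j < t → IsNthSyzygy R j (ModuleCat.of R (ResidueField R)) A →
      HasConcentratedExt t j π.transpose := by
  induction j with
  | zero =>
    rintro A π hj ⟨e⟩
    exact π.hasConcentratedExt_zero ht hj e
  | succ j ih =>
    rintro A π hj ⟨L, hL, ρ, ⟨e⟩⟩
    refine π.hasConcentratedExt_succ ht ρ e ?_ (ih _ (by omega) hL)
    -- Ext¹(Ω^j k, R) = Ext^{j+1}(k, R), which vanishes since j + 1 < t.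
    obtain ⟨e'⟩ := hL.nonempty_ext_equiv (ModuleCat.of R R) 1 one_pos
    have := ht (1 + j) (by omega)
    exact e'.toEquiv.subsingleton

end

/-! ### Reading Ext of the transpose off 0 → K → W → image → 0 -/

section Conclusion

variable {T K W : ModuleCat.{u} R} (eT : π.transpose ≃ₗ[R] T) {f : K ⟶ W} {g : W ⟶ π.image}
  {w : f ≫ g = 0} (hS : (ShortComplex.mk f g w).ShortExact)
  (hW : ∀ i, 0 < i → i ≠ t → Subsingleton (Ext W (ModuleCat.of R R) i))
include eT hS hW

omit [IsLocalRing R] in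
theorem nonempty_ext_equiv_of_gt (i : ℕ) (hi : t < i) :
    Nonempty (Ext K (ModuleCat.of R R) i ≃ₗ[R] Ext T (ModuleCat.of R R) (i + 2)) := by
  obtain ⟨e₁⟩ := nonempty_ext_equiv_shift hS (ModuleCat.of R R) i (hW _ (by omega) (by omega))
    (hW _ (by omega) (by omega))
  obtain ⟨e₂⟩ := π.nonempty_ext_transpose_equiv_image (i + 1) (by omega)
  exact ⟨e₁.trans (e₂.trans (extCongrLeft _ eT _))⟩

omit [IsLocalRing R] in
theorem nonempty_cokernel_equiv_ext :
    Nonempty ((Ext K (ModuleCat.of R R) t ⧸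
      LinearMap.range ((Ext.mk₀ f).precompOfLinear R (ModuleCat.of R R) (zero_add t))) ≃ₗ[R]
      Ext T (ModuleCat.of R R) (t + 2)) := by
  obtain ⟨e₁⟩ := nonempty_ext_equiv_cokernel hS (ModuleCat.of R R) t
    (hW _ (by omega) (by omega))
  obtain ⟨e₂⟩ := π.nonempty_ext_transpose_equiv_image (t + 1) (by omega)
  exact ⟨e₁.trans (e₂.trans (extCongrLeft _ eT _))⟩

omit [IsLocalRing R] in
theorem subsingleton_ext_of_le (hK : ∀ i < t, Subsingleton (Ext K (ModuleCat.of R R) i))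
    (h₁ : Subsingleton (Ext π.transpose (ModuleCat.of R R) 1))
    (hinj : 0 < t → ∀ x : Ext W (ModuleCat.of R R) t,
      (Ext.mk₀ f).comp x (zero_add t) = 0 → x = 0)
    (i : ℕ) (hi : 1 ≤ i) (hit : i ≤ t + 1) : Subsingleton (Ext T (ModuleCat.of R R) i) := by
  rw [← (extCongrLeft _ eT i).toEquiv.subsingleton_congr]
  obtain ⟨i, rfl⟩ := Nat.exists_eq_add_of_le' hi
  rcases i with - | i
  · exact h₁
  obtain ⟨e₂⟩ := π.nonempty_ext_transpose_equiv_image (i + 1) (by omega)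
  rw [← e₂.toEquiv.subsingleton_congr]
  refine subsingleton_of_forall_eq 0 fun z => ?_
  have hz : (Ext.mk₀ g).comp z (zero_add _) = 0 := by
    -- Only in degree t can Ext of W be nonzero; there the pullback of z to W dies on K because f ≫
    -- g = 0, and restriction to K is injective.
    by_cases hit' : i + 1 = t
    · subst hit'
      refine hinj (by omega) _ ?_
      rw [Ext.mk₀_comp_mk₀_assoc, w, Ext.mk₀_zero, Ext.zero_comp]
    · exact @Subsingleton.elim _ (hW (i + 1) (by omega) hit') _ _
  obtain ⟨y, rfl⟩ := Ext.contravariant_sequence_exact₃ hS (ModuleCat.of R R) z hz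
    (add_comm 1 i)
  have := hK i (by omega)
  rw [@Subsingleton.elim _ this y 0, Ext.comp_zero]

end Conclusion

end ProjPresentation

/-! ### The fundamental exact sequence -/

section

variable {R : Type u} [CommRing R] [IsNoetherianRing R] [IsLocalRing R] {t : ℕ}

/-- The transpose of the `t`-th syzygy of the residue field, `t` the depth, is the second cosyzygy
of the cokernel of a map from a `k`-vector space of dimension the type into a module whose `Ext`
is concentrated in degree `t`, and on `Ext^t` that map has one-dimensional image. -/
theorem ProjPresentation.exists_shortExact (ht : depth R = t) {A : ModuleCat.{u} R}
    (π : ProjPresentation R A) (hA : IsNthSyzygy R t (ModuleCat.of R (ResidueField R)) A) :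
    ∃ (K W : ModuleCat.{u} R) (f : K ⟶ W) (g : W ⟶ π.image) (w : f ≫ g = 0)
      (u : ResidueField R →ₗ[R] Ext K (ModuleCat.of R R) t),
      (ShortComplex.mk f g w).ShortExact ∧ Nonempty (K ≃ₗ[R] (Fin (ringType R) → ResidueField R)) ∧
      (∀ i, 0 < i → i ≠ t → Subsingleton (Ext W (ModuleCat.of R R) i)) ∧
      Subsingleton (Ext π.transpose (ModuleCat.of R R) 1) ∧
      (0 < t → ∀ x : Ext W (ModuleCat.of R R) t, (Ext.mk₀ f).comp x (zero_add t) = 0 → x = 0) ∧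
      Function.Injective u ∧ LinearMap.range u =
        LinearMap.range ((Ext.mk₀ f).precompOfLinear R (ModuleCat.of R R) (zero_add t)) := by
  obtain ⟨eB⟩ := nonempty_ext_equiv_bassNumber (R := R) t
  rw [← ringType_eq ht] at eB
  rcases t with - | t
  · obtain ⟨e⟩ := hA
    have e : A ≃ₗ[R] ResidueField R := e
    let l : Module.Dual R (ResidueField R) ≃ₗ[R]
        Ext (ModuleCat.of R (ResidueField R)) (ModuleCat.of R R) 0 :=
      (ModuleCat.homLinearEquiv (S := R) (M := ModuleCat.of R (ResidueField R))
        (N := ModuleCat.of R R)).symm.trans (Ext.linearEquiv₀ (R := R)).symm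
    -- In depth zero k has a nonzero linear form, which is injective; hence k is torsionless.
    have htl (a : A) (ha : ∀ ψ : Module.Dual R A, ψ a = 0) : a = 0 := by
      have := nontrivial_ext_depth ht
      have := l.toEquiv.nontrivial
      obtain ⟨ψ, hψ⟩ := exists_ne (0 : Module.Dual R (ResidueField R))
      apply e.injective
      apply injective_of_residueField ψ hψ
      rw [map_zero, map_zero]
      exact ha (ψ ∘ₗ e.toLinearMap)
    let K : ModuleCat.{u} R := ModuleCat.of R (Module.Dual R A)
    let f : K →ₗ[R] π.dual₀ := π.aug.dualMap
    let g : π.dual₀ →ₗ[R] π.image := π.dualDiff.rangeRestrict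
    have hfg : Function.Exact f g := fun ξ =>
      Subtype.ext_iff.trans (exact_dualMap π.exact π.surjective ξ)
    have hS := shortExact_of_linearMap f g
      (LinearMap.dualMap_injective_of_surjective π.surjective) hfg
      (LinearMap.surjective_rangeRestrict _)
    let u : A →ₗ[R] Ext K (ModuleCat.of R R) 0 :=
      (Ext.linearEquiv₀ (R := R)).symm.toLinearMap ∘ₗ
        (ModuleCat.homLinearEquiv (S := R) (M := K) (N := ModuleCat.of R R)).symm.toLinearMap ∘ₗ
          Module.Dual.eval R A
    have hu (a : A) : u a = Ext.mk₀ (ModuleCat.ofHom (Module.Dual.eval R A a)) := rfl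
    refine ⟨K, π.dual₀, ModuleCat.ofHom f, ModuleCat.ofHom g, _, u ∘ₗ e.symm.toLinearMap, hS,
      ⟨e.symm.dualMap.trans (l.trans eB)⟩, ?_, π.subsingleton_ext_one_transpose htl,
      fun h => absurd h (lt_irrefl 0), ?_, ?_⟩
    · intro i hi _
      obtain ⟨i, rfl⟩ := Nat.exists_eq_add_of_lt hi
      exact π.subsingleton_ext_dual₀ _ _
    · refine Function.Injective.comp (g := u) ?_ e.symm.injective
      rw [injective_iff_map_eq_zero]
      intro a ha
      refine htl a fun ψ => ?_
      have h := (Ext.linearEquiv₀ (R := R)).symm.injective (ha.trans (map_zero _).symm)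
      exact LinearMap.congr_fun (congrArg ModuleCat.Hom.hom h) ψ
    · have hcomp (p : π.P₀) :
          (Ext.mk₀ (ModuleCat.ofHom f)).comp (Ext.mk₀ (ModuleCat.ofHom (X := π.dual₀)
            (Y := ModuleCat.of R R) (Module.Dual.eval R π.P₀ p))) (zero_add 0) =
          u (π.aug p) := by
        rw [Ext.mk₀_comp_mk₀]
        rfl
      ext x
      constructor
      · rintro ⟨a, rfl⟩
        obtain ⟨p, hp⟩ := π.surjective (e.symm a)
        refine ⟨_, (hcomp p).trans ?_⟩
        rw [hp]
        rfl
      · rintro ⟨y, rfl⟩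
        obtain ⟨η, rfl⟩ := (Ext.linearEquiv₀ (R := R)).symm.surjective y
        obtain ⟨p, hp⟩ := (Module.evalEquiv R π.P₀).surjective η.hom
        have hη : η = ModuleCat.ofHom (X := π.dual₀) (Y := ModuleCat.of R R)
          (Module.Dual.eval R π.P₀ p) := ModuleCat.hom_ext hp.symm
        refine ⟨e (π.aug p), ?_⟩
        rw [LinearMap.comp_apply, LinearEquiv.coe_coe, e.symm_apply_apply, hη]
        exact (hcomp p).symm
  · obtain ⟨L, hL, ρ, ⟨e⟩⟩ := hA
    have hC := (π.splice ρ e).hasConcentratedExt (subsingleton_ext_of_lt_depth ht) t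
      (Nat.lt_succ_self t) hL
    obtain ⟨e₁⟩ := π.nonempty_kerToImage_equiv_ext ρ e
    obtain ⟨e₂⟩ := hL.nonempty_ext_equiv (ModuleCat.of R R) 1 one_pos
    rw [add_comm 1 t] at e₂
    let eK := e₁.trans (e₂.trans eB)
    obtain ⟨v⟩ := hC.nonempty_equiv
    let K := π.kerToImage ρ e
    let W := (π.splice ρ e).transpose
    let f : K ⟶ W := ModuleCat.ofHom (Submodule.subtype _)
    let c : Ext W (ModuleCat.of R R) (t + 1) →ₗ[R] Ext K (ModuleCat.of R R) (t + 1) :=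
      (Ext.mk₀ f).precompOfLinear R (ModuleCat.of R R) (zero_add (t + 1))
    have hr := ringType_pos ht
    -- A line in K, available because the type is positive; its inclusion into W is the nonzero
    -- class of degree 0 to be detected.
    let κ : ModuleCat.of R (ResidueField R) ⟶ K := ModuleCat.ofHom
      (eK.symm.toLinearMap ∘ₗ LinearMap.single R (fun _ => ResidueField R) ⟨0, hr⟩)
    have hκ : Function.Injective (κ ≫ f).hom :=
      (Submodule.subtype_injective _).comp (eK.symm.injective.comp
        fun a b h => by simpa using congrFun h ⟨0, hr⟩)
    obtain ⟨x, hx⟩ := hC.exists_comp_ne_zero 0 (zero_add _) (Ext.mk₀ (κ ≫ f)) (by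
      intro h0
      have h0 : κ ≫ f = 0 := Ext.homEquiv₀.symm.injective (h0.trans (Ext.mk₀_zero _ _).symm)
      rw [h0] at hκ
      exact one_ne_zero (α := ResidueField R) (hκ rfl))
    have hu : Function.Injective (c ∘ₗ v.toLinearMap) := by
      refine injective_of_residueField _ fun h0 => hx ?_
      have h1 : c x = 0 := by
        have := LinearMap.congr_fun h0 (v.symm x)
        rwa [LinearMap.comp_apply, LinearEquiv.coe_coe, v.apply_symm_apply] at this
      have h1 : (Ext.mk₀ f).comp x (zero_add _) = 0 := h1
      rw [← Ext.mk₀_comp_mk₀_assoc, h1, Ext.comp_zero]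
    refine ⟨K, W, f, π.toImage ρ e, _, c ∘ₗ v.toLinearMap, π.shortExact_kerToImage ρ e, ⟨eK⟩,
      hC.subsingleton, π.subsingleton_ext_one_transpose (ρ.torsionless_of_incl e), ?_, hu, ?_⟩
    · intro _ y hy
      rw [← v.apply_symm_apply y]
      rw [hu (a₁ := v.symm y) (a₂ := 0), map_zero]
      rw [LinearMap.comp_apply, LinearEquiv.coe_coe, v.apply_symm_apply, map_zero]
      exact hy
    · rw [LinearMap.range_comp, LinearEquiv.range, Submodule.map_top]

end

end LocalSyzygy

/-! ### The theorem -/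

theorem corollary3p6 {R : Type u} [CommRing R] [IsNoetherianRing R] [IsLocalRing R]
    (t : ℕ) (ht : LocalSyzygy.depth R = t)
    (S T : ModuleCat.{u} R)
    (hS : LocalSyzygy.IsNthSyzygy R t (ModuleCat.of R (ResidueField R)) S)
    (hT : LocalSyzygy.IsTranspose R S T) :
    ∃ h : ∀ i : ℕ, 0 < i → LocalSyzygy.IsResidueSpace R (Ext T (ModuleCat.of R R) i),
      (∀ i : ℕ, 1 ≤ i → i ≤ t + 1 → Subsingleton (Ext T (ModuleCat.of R R) i)) ∧
      -- addition of one on the left instead of subtraction on the right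
      (h (t + 2) (by omega)).dim + 1 = ((LocalSyzygy.ringType R ^ 2 : ℕ) : Cardinal.{u}) ∧
      (∀ (i : ℕ) (hi : t + 3 ≤ i),
        (h i (by omega)).dim =
          ((LocalSyzygy.ringType R * LocalSyzygy.bassNumber R (i - 2) : ℕ) : Cardinal.{u})) := by
  open LocalSyzygy in
  obtain ⟨π, ⟨eT⟩⟩ := hT
  have eT : π.transpose ≃ₗ[R] T := eT.symm
  obtain ⟨K, W, f, g, w, u, hE, ⟨eK⟩, hW, h₁, hinj, hu, hur⟩ := π.exists_shortExact ht hS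
  have hK (i : ℕ) := nonempty_ext_equiv_of_equiv_pi eK i
  have hsub : ∀ i : ℕ, 1 ≤ i → i ≤ t + 1 → Subsingleton (Ext T (ModuleCat.of R R) i) := by
    refine π.subsingleton_ext_of_le eT hE hW (fun i hi => ?_) h₁ hinj
    have := subsingleton_ext_of_lt_depth ht i hi
    obtain ⟨e⟩ := nonempty_ext_pi_equiv (ModuleCat.of R R) (ModuleCat.of R (ResidueField R))
      (ringType R) i
    let eK' : K ≃ₗ[R] ModuleCat.of R
      (Fin (ringType R) → ModuleCat.of R (ResidueField R)) := eK
    exact ((extCongrLeft _ eK' i).trans e).toEquiv.subsingleton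
  obtain ⟨q⟩ := π.nonempty_cokernel_equiv_ext eT hE hW
  obtain ⟨eV⟩ := hK t
  -- Ext^t(K, R) has dimension r·μ_t = r², and the image of Ext^t(W, R) is the line removed.
  obtain ⟨hd, hdim⟩ := dim_quotient_add_one eV u hu ((Submodule.quotEquivOfEq _ _ hur).trans q)
  have hlarge : ∀ i : ℕ, t + 3 ≤ i → Nonempty (Ext T (ModuleCat.of R R) i ≃ₗ[R]
      (Fin (ringType R * bassNumber R (i - 2)) → ResidueField R)) := by
    intro i hi
    obtain ⟨i, rfl⟩ := Nat.exists_eq_add_of_le' (show 2 ≤ i by omega)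
    obtain ⟨e⟩ := π.nonempty_ext_equiv_of_gt eT hE hW i (by omega)
    obtain ⟨e'⟩ := hK i
    exact ⟨e.symm.trans e'⟩
  refine ⟨fun i hi => ?_, hsub, ?_, fun i hi => ?_⟩
  · rcases lt_trichotomy i (t + 2) with h | rfl | h
    · intro x r
      exact @Subsingleton.elim _ (hsub i hi (by omega)) _ _
    · exact hd
    · obtain ⟨e⟩ := hlarge i h
      exact isResidueSpace_of_equiv e
  · rw [hdim, sq, ringType_eq ht]
  · obtain ⟨e⟩ := hlarge i hi
    exact IsResidueSpace.dim_eq _ e
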